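/- Let $K\ge 1$ and $0\le\gamma\le n$ be integers with $K<n$. In the random $K$-out graph on the nodes $\{1,\dots,n\}$ each node $i$ selects a set $\Gamma_i\subseteq\{1,\dots,n\}\setminus\{i\}$ of exactly $K$ nodes, uniformly at random, the sets $\Gamma_1,\dots,\Gamma_n$ being mutually independent; distinct nodes $i,j$ are adjacent if $j\in\Gamma_i$ or $i\in\Gamma_j$. Let $D$ be a uniformly random set of $\gamma$ nodes, independent of the graph, and let $P(n,K,\gamma)$ be the probability that the subgraph induced on $\{1,\dots,n\}\setminus D$ is connected. Theorem. Let $\alpha\in(0,1)$ and let $\gamma_n=\alpha n$, rounded up or down to an integer when $\alpha n$ is not one (that is, $\gamma_n\in\mathbb{N}_0$ with $|\gamma_n-\alpha n|<1$ for all $n$). Let $c>0$ and let $K:\mathbb{N}_0\to\mathbb{N}_0$ satisfy $2\le K_n<n$ for all $n\ge 3$ and $$K_n\sim c\cdot\frac{\log n}{1-\alpha-\log\alpha}\qquad(n\to\infty),$$ meaning that the ratio of the two sides tends to $1$. Then $$\lim_{n\to\infty}P(n,K_n,\gamma_n)=\begin{cases}1,&\text{if } c>1,\\ 0,&\text{if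 } 0<c<1.\end{cases}$$ -/

import Mathlib

open Filter Topology MeasureTheory ProbabilityTheory Asymptotics

namespace KOut

/-- A scaling: a choice `K n` of the number of selections made by each of `n` nodes, with
`2 ≤ K n < n` (the range is non-empty only from `n = 3` on). -/
def IsScaling (K : ℕ → ℕ) : Prop :=
  ∀ n, 3 ≤ n → 2 ≤ K n ∧ K n < n

/-- The graph on `n` labelled nodes in which distinct `i`, `j` are adjacent when at least one
of them selects the other, `Γ i` being the set of labels selected by node `i`. -/
def selectionGraph {n : ℕ} (Γ : Fin n → Finset (Fin n)) : SimpleGraph (Fin n) where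
  Adj i j := i ≠ j ∧ (j ∈ Γ i ∨ i ∈ Γ j)
  symm := ⟨fun _ _ h => ⟨h.1.symm, h.2.symm⟩⟩
  loopless := ⟨fun _ h => h.1 rfl⟩

/-- The graph that remains of the selection graph when the set `D` of nodes is deleted. -/
def remainingGraph {n : ℕ} (Γ : Fin n → Finset (Fin n)) (D : Finset (Fin n)) :
    SimpleGraph {i : Fin n // i ∉ D} :=
  (selectionGraph Γ).induce {i | i ∉ D}

/-- The law of the selections: node `i` selects a uniformly random set of `K` labels different
from `i`, and the `n` selections are mutually independent. -/
noncomputable def selectionLaw (n K : ℕ) : Measure (Fin n → Finset (Fin n)) :=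
  Measure.pi fun i => uniformOn {S : Finset (Fin n) | i ∉ S ∧ S.card = K}

/-- The law of the set of deleted nodes: a uniformly random set of `γ` nodes. -/
noncomputable def deletionLaw (n γ : ℕ) : Measure (Finset (Fin n)) :=
  uniformOn {D : Finset (Fin n) | D.card = γ}

/-- The probability that the random `K`-out graph on `n` nodes is connected after deletion of
`γ` uniformly random nodes, chosen independently of the graph. -/
noncomputable def connectivityProb (n K γ : ℕ) : ℝ :=
  ((selectionLaw n K).prod (deletionLaw n γ)).real
    {ω | (remainingGraph ω.1 ω.2).Connected}

/-- The threshold function `log n / (1 - α - log α)`. -/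
noncomputable def threshold (α : ℝ) (n : ℕ) : ℝ :=
  Real.log n / (1 - α - Real.log α)

end KOut

/-! Fix the deleted set `D`, with `γ` elements. A set `S` of `r` remaining nodes is cut off exactly
when every node avoids prescribed labels, so by independence the probability is a product of
binomial ratios. With `u = (γ + r) / n` it is at most `exp (-r K (1 - u - log u))`
(`selectionLaw_real_cut_le`): the `r` nodes of `S` may select only inside `D ∪ S`, giving `u ^ (K
r)`, and the other `n (1 - u)` nodes must miss `S`. For `r = 1` the exponent is about `-K * rate α`,
which balances the `n` possible choices at `K = log n / rate α`.

Above the threshold a union bound over cuts with at most half of the remaining nodes suffices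
(`selectionLaw_real_not_connected_le`). For `u ≤ u₀`, with `u₀` slightly above `α`, the sum is at
most `exp (n q) - 1` with `q = exp (-K * rate u₀)` and `n q → 0`; larger sets have linear size, and
`K → ∞` beats their number, at most `2 ^ n`.

Below the threshold the expected number of isolated nodes tends to infinity. Two nodes are isolated
almost independently, so by the second moment method an isolated node exists with probability
tending to 1 (`selectionLaw_real_connected_le`). -/

namespace KOut

/-! ### Ratios of binomial coefficients -/

/-- The probability that a uniformly random set of `K` among `n - 1` labels avoids `a` given
ones. -/
noncomputable def avoidProb (n K a : ℕ) : ℝ :=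
  ((n - 1 - a).choose K : ℝ) / ((n - 1).choose K : ℝ)

lemma choose_div_choose_eq_descFactorial_div (M N K : ℕ) :
    (M.choose K : ℝ) / (N.choose K : ℝ) = (M.descFactorial K : ℝ) / (N.descFactorial K : ℝ) := by
  rw [Nat.descFactorial_eq_factorial_mul_choose, Nat.descFactorial_eq_factorial_mul_choose]
  push_cast
  rw [mul_div_mul_left _ _ (by exact_mod_cast K.factorial_ne_zero)]

/-- Factor by factor, `(M - k) / (N - k) ≤ M / N` because `M ≤ N`. -/
lemma choose_div_choose_le_pow {M N : ℕ} (hMN : M ≤ N) (K : ℕ) (hK : K ≤ N) :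
    (M.choose K : ℝ) / (N.choose K : ℝ) ≤ ((M : ℝ) / N) ^ K := by
  rw [choose_div_choose_eq_descFactorial_div]
  induction K with
  | zero => simp
  | succ k ih =>
    rw [Nat.descFactorial_succ, Nat.descFactorial_succ, pow_succ']
    push_cast
    rw [mul_div_mul_comm]
    have hkN : (k : ℝ) < N := by exact_mod_cast hK
    have hk0 : (0 : ℝ) ≤ k := k.cast_nonneg
    have hMN' : (M : ℝ) ≤ N := by exact_mod_cast hMN
    refine mul_le_mul ?_ (ih (by omega)) (by positivity) (by positivity)
    rw [Nat.cast_sub (by omega : k ≤ N), div_le_div_iff₀ (by linarith) (by linarith)]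
    -- For `k ≥ M` the truncated difference `M - k` is zero.
    rcases le_total k M with h | h
    · rw [Nat.cast_sub h]
      nlinarith
    · rw [Nat.sub_eq_zero_of_le h]
      simp only [Nat.cast_zero, zero_mul]
      exact mul_nonneg (by positivity) (by linarith)

/-- Each of the `K` factors of the falling factorial of `M` is at least `M - K`, and each of those
of `N` is at most `N`. -/
lemma pow_le_choose_div_choose {M N K : ℕ} (hKM : K ≤ M) (hMN : M ≤ N) :
    (((M : ℝ) - K) / N) ^ K ≤ (M.choose K : ℝ) / (N.choose K : ℝ) := by
  rw [choose_div_choose_eq_descFactorial_div, div_pow]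
  have h1 : ((M : ℝ) - K) ^ K ≤ (M.descFactorial K : ℝ) := by
    have h := (Nat.pow_le_pow_left (by omega : M - K ≤ M + 1 - K) K).trans
      (Nat.pow_sub_le_descFactorial M K)
    rw [← Nat.cast_sub hKM]
    exact_mod_cast h
  have h2 : (N.descFactorial K : ℝ) ≤ (N : ℝ) ^ K := by
    exact_mod_cast Nat.descFactorial_le_pow N K
  have h3 : (0 : ℝ) < N.descFactorial K := by
    exact_mod_cast Nat.pos_of_ne_zero (by rw [Ne, Nat.descFactorial_eq_zero_iff_lt]; omega)
  exact div_le_div₀ (by positivity) h1 h3 h2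

lemma avoidProb_nonneg (n K a : ℕ) : 0 ≤ avoidProb n K a := by
  unfold avoidProb; positivity

lemma avoidProb_zero {n K : ℕ} (hK : K < n) : avoidProb n K 0 = 1 := by
  have : (n - 1).choose K ≠ 0 := (Nat.choose_pos (by omega)).ne'
  simp [avoidProb, this]

lemma avoidProb_le_pow {n K a : ℕ} (hK : K < n) (ha : a < n) :
    avoidProb n K a ≤ (1 - (a : ℝ) / n) ^ K := by
  refine (choose_div_choose_le_pow (by omega) K (by omega)).trans ?_
  gcongr
  have han : (a : ℝ) + 1 ≤ n := by exact_mod_cast ha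
  have hn0 : (0 : ℝ) < n := by exact_mod_cast (Nat.zero_le a).trans_lt ha
  rcases Nat.lt_or_ge 1 n with h | h
  · have hn1 : (1 : ℝ) < n := by exact_mod_cast h
    rw [Nat.cast_sub (by omega), Nat.cast_sub (by omega), Nat.cast_one, one_sub_div hn0.ne',
      div_le_div_iff₀ (by linarith) hn0]
    nlinarith [(Nat.cast_nonneg a : (0 : ℝ) ≤ a)]
  -- Here `n = 1` and `a = 0`; the base of the power is `0 / 0 = 0`.
  · have : n - 1 = 0 := by omega
    rw [this]
    simp only [Nat.zero_sub, Nat.cast_zero, div_zero]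
    rw [sub_nonneg, div_le_one hn0]
    linarith

lemma avoidProb_one {n K : ℕ} (hn : 2 ≤ n) (hK : K < n) :
    avoidProb n K 1 = 1 - (K : ℝ) / (n - 1 : ℝ) := by
  obtain ⟨N, rfl⟩ : ∃ N, n = N + 2 := ⟨n - 2, by omega⟩
  have h := Nat.choose_mul_succ_eq N K
  have h' : ((N.choose K : ℝ)) * (N + 1) = ((N + 1).choose K : ℝ) * (N + 1 - K) := by
    have := congrArg (Nat.cast (R := ℝ)) h
    push_cast [Nat.cast_sub (by omega : K ≤ N + 1)] at this
    exact this
  have hp : (0 : ℝ) < ((N + 1).choose K : ℝ) := by exact_mod_cast Nat.choose_pos (by omega)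
  have hN : (0 : ℝ) < (N : ℝ) + 1 := by positivity
  simp only [avoidProb, Nat.add_sub_cancel, show N + 2 - 1 = N + 1 by omega]
  push_cast
  rw [show ((N : ℝ) + 2 - 1) = N + 1 by ring, one_sub_div hN.ne', div_eq_div_iff hp.ne' hN.ne']
  linarith

/-- Avoiding two labels is at most as likely as it would be for independent choices. -/
lemma avoidProb_two_le {n K : ℕ} (hn : 3 ≤ n) (hK : K + 1 < n) :
    avoidProb n K 2 ≤ avoidProb n K 1 ^ 2 := by
  obtain ⟨N, rfl⟩ : ∃ N, n = N + 3 := ⟨n - 3, by omega⟩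
  have e1 := avoidProb_one (n := N + 3) (K := K) (by omega) (by omega)
  have e2 := avoidProb_one (n := N + 2) (K := K) (by omega) (by omega)
  -- Chain rule: once one label is known to be avoided, the choice is uniform over one label fewer,
  -- which makes avoiding the second one less likely.
  have e3 : avoidProb (N + 3) K 2 = avoidProb (N + 2) K 1 * avoidProb (N + 3) K 1 := by
    have hp : (0 : ℝ) < ((N + 1).choose K : ℝ) := by exact_mod_cast Nat.choose_pos (by omega)
    simp only [avoidProb, show N + 3 - 1 - 2 = N by omega, show N + 2 - 1 = N + 1 by omega,
      show N + 3 - 1 - 1 = N + 1 by omega, Nat.add_sub_cancel]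
    rw [div_mul_div_cancel₀ hp.ne']
  rw [e3, sq]
  refine mul_le_mul_of_nonneg_right ?_ (avoidProb_nonneg _ _ _)
  rw [e1, e2]
  push_cast
  have : (0 : ℝ) < (N : ℝ) + 2 - 1 := by linarith [(N.cast_nonneg : (0 : ℝ) ≤ N)]
  gcongr
  norm_num

/-! ### The law of the selections -/

lemma card_filter_selections_disjoint {n K : ℕ} (i : Fin n) (A : Finset (Fin n)) (hi : i ∉ A) :
    (Finset.univ.filter fun S : Finset (Fin n) => (i ∉ S ∧ S.card = K) ∧ Disjoint S A).card =
      (n - 1 - A.card).choose K := by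
  have h : (Finset.univ.filter fun S : Finset (Fin n) =>
      (i ∉ S ∧ S.card = K) ∧ Disjoint S A) = Finset.powersetCard K (insert i A)ᶜ := by
    ext S
    simp only [Finset.mem_filter, Finset.mem_univ, true_and, Finset.mem_powersetCard,
      Finset.subset_compl_iff_disjoint_right, Finset.disjoint_insert_right]
    tauto
  rw [h, Finset.card_powersetCard, Finset.card_compl, Finset.card_insert_of_notMem hi,
    Fintype.card_fin]
  congr 1
  omega

lemma exists_selection {n K : ℕ} (hK : K < n) (i : Fin n) :
    {S : Finset (Fin n) | i ∉ S ∧ S.card = K}.Nonempty := by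
  obtain ⟨S, hS, hc⟩ := Finset.exists_subset_card_eq (s := ({i}ᶜ : Finset (Fin n))) (n := K)
    (by rw [Finset.card_compl, Finset.card_singleton, Fintype.card_fin]; omega)
  exact ⟨S, fun h => by simpa using hS h, hc⟩

lemma isProbabilityMeasure_selection {n K : ℕ} (hK : K < n) (i : Fin n) :
    IsProbabilityMeasure (uniformOn {S : Finset (Fin n) | i ∉ S ∧ S.card = K}) :=
  isProbabilityMeasure_uniformOn (Set.toFinite _) (exists_selection hK i)

lemma isProbabilityMeasure_selectionLaw {n K : ℕ} (hK : K < n) :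
    IsProbabilityMeasure (selectionLaw n K) := by
  have := isProbabilityMeasure_selection hK
  unfold selectionLaw
  infer_instance

lemma isProbabilityMeasure_deletionLaw {n γ : ℕ} (hγ : γ ≤ n) :
    IsProbabilityMeasure (deletionLaw n γ) := by
  refine isProbabilityMeasure_uniformOn (Set.toFinite _) ?_
  obtain ⟨S, -, hc⟩ := Finset.exists_subset_card_eq (s := (Finset.univ : Finset (Fin n)))
    (n := γ) (by simpa using hγ)
  exact ⟨S, hc⟩

lemma selection_real_disjoint {n K : ℕ} (i : Fin n) (A : Finset (Fin n)) (hi : i ∉ A) :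
    (uniformOn {S : Finset (Fin n) | i ∉ S ∧ S.card = K}).real {S | Disjoint S A} =
      avoidProb n K A.card := by
  have h0 := card_filter_selections_disjoint (K := K) i ∅ (Finset.notMem_empty i)
  have h1 := card_filter_selections_disjoint (K := K) i A hi
  simp only [Finset.disjoint_empty_right, and_true, Finset.card_empty, Nat.sub_zero] at h0
  have e0 : {S : Finset (Fin n) | i ∉ S ∧ S.card = K} =
      ((Finset.univ.filter fun S : Finset (Fin n) => i ∉ S ∧ S.card = K : Finset _) : Set _) := by
    simp
  have e1 : {S : Finset (Fin n) | Disjoint S A} =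
      ((Finset.univ.filter fun S : Finset (Fin n) => Disjoint S A : Finset _) : Set _) := by
    simp
  rw [e0, e1, measureReal_def, uniformOn_apply_finset, ← Finset.filter_and, h0, h1]
  simp [avoidProb]

/-- The selections avoid prescribed sets of labels independently. -/
lemma selectionLaw_real_forall_disjoint {n K : ℕ} (hK : K < n) (A : Fin n → Finset (Fin n))
    (hA : ∀ i, i ∉ A i) :
    (selectionLaw n K).real {Γ | ∀ i, Disjoint (Γ i) (A i)} =
      ∏ i, avoidProb n K (A i).card := by
  have := isProbabilityMeasure_selection hK
  have e : {Γ : Fin n → Finset (Fin n) | ∀ i, Disjoint (Γ i) (A i)} =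
      Set.univ.pi fun i => {S | Disjoint S (A i)} := by
    ext Γ; simp
  rw [e, selectionLaw, measureReal_def, Measure.pi_pi, ENNReal.toReal_prod]
  exact Finset.prod_congr rfl fun i _ => selection_real_disjoint i (A i) (hA i)

/-! ### Conditioning on the set of deleted nodes -/

/-- By Fubini, since the deletion law is concentrated on sets of size `γ`, a bound uniform over such
`D` carries over to the product law. -/
lemma selectionLaw_prod_deletionLaw_real_le {n K γ : ℕ} (hK : K < n) (hγ : γ ≤ n) {ε : ℝ}
    (hε : 0 ≤ ε) (E : Set ((Fin n → Finset (Fin n)) × Finset (Fin n)))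
    (h : ∀ D : Finset (Fin n), D.card = γ → (selectionLaw n K).real {Γ | (Γ, D) ∈ E} ≤ ε) :
    ((selectionLaw n K).prod (deletionLaw n γ)).real E ≤ ε := by
  have := isProbabilityMeasure_selectionLaw hK
  have := isProbabilityMeasure_deletionLaw hγ
  rw [measureReal_def, Measure.prod_apply_symm MeasurableSet.of_discrete]
  refine ENNReal.toReal_le_of_le_ofReal hε ?_
  calc _ ≤ ∫⁻ _, ENNReal.ofReal ε ∂(deletionLaw n γ) := by
        refine lintegral_mono_ae ?_
        have hae : ∀ᵐ D ∂(deletionLaw n γ), D ∈ {D : Finset (Fin n) | D.card = γ} :=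
          ae_cond_mem MeasurableSet.of_discrete
        filter_upwards [hae] with D hD
        rw [← ENNReal.ofReal_toReal (measure_ne_top (selectionLaw n K) _)]
        exact ENNReal.ofReal_le_ofReal (h D hD)
    _ = ENNReal.ofReal ε := by simp

lemma connectivityProb_le {n K γ : ℕ} (hK : K < n) (hγ : γ ≤ n) {ε : ℝ} (hε : 0 ≤ ε)
    (h : ∀ D : Finset (Fin n), D.card = γ →
      (selectionLaw n K).real {Γ | (remainingGraph Γ D).Connected} ≤ ε) :
    connectivityProb n K γ ≤ ε :=
  selectionLaw_prod_deletionLaw_real_le hK hγ hε _ h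

lemma one_sub_le_connectivityProb {n K γ : ℕ} (hK : K < n) (hγ : γ ≤ n) {ε : ℝ} (hε : 0 ≤ ε)
    (h : ∀ D : Finset (Fin n), D.card = γ →
      (selectionLaw n K).real {Γ | ¬ (remainingGraph Γ D).Connected} ≤ ε) :
    1 - ε ≤ connectivityProb n K γ := by
  have := isProbabilityMeasure_selectionLaw hK
  have := isProbabilityMeasure_deletionLaw hγ
  have hc := selectionLaw_prod_deletionLaw_real_le hK hγ hε
    {ω | (remainingGraph ω.1 ω.2).Connected}ᶜ h
  rw [probReal_compl_eq_one_sub MeasurableSet.of_discrete] at hc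
  rw [connectivityProb]
  linarith

lemma connectivityProb_nonneg (n K γ : ℕ) : 0 ≤ connectivityProb n K γ :=
  measureReal_nonneg

lemma connectivityProb_le_one {n K γ : ℕ} (hK : K < n) (hγ : γ ≤ n) :
    connectivityProb n K γ ≤ 1 := by
  have := isProbabilityMeasure_selectionLaw hK
  have := isProbabilityMeasure_deletionLaw hγ
  exact measureReal_le_one

/-! ### Cuts of the remaining graph -/

/-- Take the component of a vertex or its complement, whichever is smaller. -/
lemma exists_small_cut_of_not_connected {V : Type*} [Fintype V] [DecidableEq V] [Nonempty V]
    {G : SimpleGraph V} (hG : ¬ G.Connected) :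
    ∃ S : Finset V, S.Nonempty ∧ 2 * S.card ≤ Fintype.card V ∧
      ∀ x ∈ S, ∀ y ∉ S, ¬ G.Adj x y := by
  classical
  have hp : ¬ G.Preconnected := fun h => hG ⟨h⟩
  simp only [SimpleGraph.Preconnected, not_forall] at hp
  obtain ⟨a, b, hab⟩ := hp
  let S : Finset V := Finset.univ.filter fun x => G.Reachable a x
  have hcut : ∀ x ∈ S, ∀ y ∉ S, ¬ G.Adj x y := by
    intro x hx y hy hxy
    simp only [S, Finset.mem_filter, Finset.mem_univ, true_and] at hx hy
    exact hy (hx.trans hxy.reachable)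
  by_cases h : 2 * S.card ≤ Fintype.card V
  · exact ⟨S, ⟨a, by simp [S]⟩, h, hcut⟩
  · refine ⟨Sᶜ, ⟨b, by simp [S, hab]⟩, ?_, ?_⟩
    · have := Finset.card_compl_add_card S
      omega
    · intro x hx y hy hxy
      rw [Finset.mem_compl] at hx
      rw [Finset.mem_compl, not_not] at hy
      exact hcut y hy x hx hxy.symm

/-- The labels that each node has to avoid so that the set `S` of remaining nodes is cut off
from the other remaining nodes, when the nodes in `D` are deleted. -/
def cutLabels {n : ℕ} (D S : Finset (Fin n)) (i : Fin n) : Finset (Fin n) :=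
  if i ∈ S then Dᶜ \ S else if i ∈ D then ∅ else S

lemma notMem_cutLabels {n : ℕ} (D S : Finset (Fin n)) (i : Fin n) : i ∉ cutLabels D S i := by
  unfold cutLabels
  split_ifs <;> simp_all

/-- This turns disconnection into avoidance events, one for each node separately, so that
independence applies. -/
lemma exists_cutLabels_disjoint_of_not_connected {n : ℕ} {Γ : Fin n → Finset (Fin n)}
    {D : Finset (Fin n)} (hD : D.card < n) (h : ¬ (remainingGraph Γ D).Connected) :
    ∃ S ⊆ Dᶜ, S.Nonempty ∧ 2 * S.card ≤ n - D.card ∧ ∀ i, Disjoint (Γ i) (cutLabels D S i) := by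
  classical
  have hcard : Fintype.card {i : Fin n // i ∉ D} = n - D.card := by
    rw [Fintype.card_subtype_compl, Fintype.card_fin, Fintype.card_coe]
  have : Nonempty {i : Fin n // i ∉ D} := Fintype.card_pos_iff.1 (by omega)
  obtain ⟨T, hT, hTc, hcut⟩ := exists_small_cut_of_not_connected h
  rw [hcard] at hTc
  refine ⟨T.map (Function.Embedding.subtype _), ?_, by simpa using hT, by simpa using hTc, ?_⟩
  · intro x hx
    obtain ⟨y, -, rfl⟩ := Finset.mem_map.1 hx
    simpa using y.2
  · have hnot : ∀ x ∈ T.map (Function.Embedding.subtype (· ∉ D)), ∀ y,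
        y ∉ T.map (Function.Embedding.subtype (· ∉ D)) → y ∉ D → y ∉ Γ x ∧ x ∉ Γ y := by
      intro x hx y hy hyD
      obtain ⟨x, hxT, rfl⟩ := Finset.mem_map.1 hx
      have hyT : (⟨y, hyD⟩ : {i : Fin n // i ∉ D}) ∉ T := fun h' =>
        hy (Finset.mem_map.2 ⟨_, h', rfl⟩)
      have hne : (x : Fin n) ≠ y := fun e => hyT (by simpa [← e] using hxT)
      have hadj : ¬ ((x : Fin n) ≠ y ∧ (y ∈ Γ x ∨ (x : Fin n) ∈ Γ y)) := hcut x hxT _ hyT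
      simp only [Function.Embedding.subtype_apply]
      tauto
    intro i
    rw [Finset.disjoint_right]
    intro j hj
    unfold cutLabels at hj
    split_ifs at hj with hi hiD
    · rw [Finset.mem_sdiff, Finset.mem_compl] at hj
      exact (hnot i hi j hj.2 hj.1).1
    · simp at hj
    · exact (hnot j hj i hi hiD).2

/-- The exponential decay rate, per node and selection, of the probability that a set of nodes
is cut off when it makes up the fraction `u` together with the deleted nodes; the threshold of
the zero-one law is `log n / rate α`. -/
noncomputable def rate (u : ℝ) : ℝ := 1 - u - Real.log u

lemma rate_anti {u v : ℝ} (hu : 0 < u) (huv : u ≤ v) : rate v ≤ rate u := by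
  have := Real.log_le_log hu huv
  unfold rate
  linarith

lemma rate_pos {u : ℝ} (hu : 0 < u) (hu1 : u < 1) : 0 < rate u := by
  have := Real.log_neg hu hu1
  unfold rate
  linarith

/-- Deleted nodes are unconstrained and contribute 1; nodes of `S` avoid all remaining nodes outside
`S`, and those in turn avoid `S`. -/
lemma prod_cutLabels {n K : ℕ} (hK : K < n) {D S : Finset (Fin n)} (hS : S ⊆ Dᶜ) :
    ∏ i, avoidProb n K (cutLabels D S i).card =
      avoidProb n K (n - D.card - S.card) ^ S.card *
        avoidProb n K S.card ^ (n - D.card - S.card) := by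
  have hcard : (Dᶜ \ S).card = n - D.card - S.card := by
    rw [Finset.card_sdiff_of_subset hS, Finset.card_compl, Fintype.card_fin]
  have hsplit : (Finset.univ : Finset (Fin n)) = D ∪ (S ∪ (Dᶜ \ S)) := by
    rw [Finset.union_sdiff_of_subset hS, Finset.union_compl]
  have hd1 : Disjoint D (S ∪ (Dᶜ \ S)) := by
    rw [Finset.union_sdiff_of_subset hS]
    exact disjoint_compl_right
  rw [hsplit, Finset.prod_union hd1, Finset.prod_union Finset.disjoint_sdiff]
  have h1 : ∏ i ∈ D, avoidProb n K (cutLabels D S i).card = 1 := by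
    refine Finset.prod_eq_one fun i hi => ?_
    have hiS : i ∉ S := fun h => Finset.mem_compl.1 (hS h) hi
    simp [cutLabels, hi, hiS, avoidProb_zero hK]
  have h2 : ∏ i ∈ S, avoidProb n K (cutLabels D S i).card =
      avoidProb n K (n - D.card - S.card) ^ S.card := by
    refine Finset.prod_eq_pow_card fun i hi => ?_
    simp [cutLabels, hi, hcard]
  have h3 : ∏ i ∈ Dᶜ \ S, avoidProb n K (cutLabels D S i).card =
      avoidProb n K S.card ^ (n - D.card - S.card) := by
    rw [← hcard]
    refine Finset.prod_eq_pow_card fun i hi => ?_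
    rw [Finset.mem_sdiff, Finset.mem_compl] at hi
    simp [cutLabels, hi]
  rw [h1, h2, h3, one_mul]

/-- The probability that a given set `S` is cut off. -/
lemma selectionLaw_real_cut_le {n K : ℕ} (hK : K < n) {D S : Finset (Fin n)} (hS : S ⊆ Dᶜ)
    (hS0 : S.Nonempty) (hSn : S.card < n - D.card) (hD : 0 < D.card) :
    (selectionLaw n K).real {Γ | ∀ i, Disjoint (Γ i) (cutLabels D S i)} ≤
      Real.exp (-(S.card * (K * rate ((D.card + S.card) / n)))) := by
  rw [selectionLaw_real_forall_disjoint hK _ (notMem_cutLabels D S), prod_cutLabels hK hS]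
  have hr := hS0.card_pos
  set r := S.card
  set g := D.card
  have hn0 : (0 : ℝ) < n := by exact_mod_cast (Nat.zero_le K).trans_lt hK
  set u : ℝ := (g + r) / n with hu
  have hu0 : 0 < u := by positivity
  have hcast : ((n - g - r : ℕ) : ℝ) = n - g - r := by
    rw [Nat.cast_sub (by omega), Nat.cast_sub (by omega)]
  -- The base `1 - (n - g - r) / n` is exactly `u`.
  have h1 : avoidProb n K (n - g - r) ≤ Real.exp (K * Real.log u) := by
    refine (avoidProb_le_pow hK (by omega)).trans (le_of_eq ?_)
    rw [hcast, mul_comm, Real.exp_mul, Real.exp_log hu0, Real.rpow_natCast]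
    congr 1
    rw [hu]
    field_simp
    ring
  have h2 : avoidProb n K r ≤ Real.exp (-(r * K / n)) := by
    refine (avoidProb_le_pow hK (by omega)).trans ?_
    have hrn : (r : ℝ) ≤ n := by exact_mod_cast (by omega : r ≤ n)
    calc (1 - (r : ℝ) / n) ^ K ≤ Real.exp (-((r : ℝ) / n)) ^ K := by
          have h0 : 0 ≤ 1 - (r : ℝ) / n := by
            rw [sub_nonneg, div_le_one hn0]; exact hrn
          exact pow_le_pow_left₀ h0 (Real.one_sub_le_exp_neg _) K
      _ = _ := by
          rw [← Real.exp_nat_mul]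
          congr 1
          ring
  calc _ ≤ Real.exp (K * Real.log u) ^ r * Real.exp (-(r * K / n)) ^ (n - g - r) := by
        refine mul_le_mul (pow_le_pow_left₀ (avoidProb_nonneg _ _ _) h1 _)
          (pow_le_pow_left₀ (avoidProb_nonneg _ _ _) h2 _)
          (pow_nonneg (avoidProb_nonneg _ _ _) _) (by positivity)
    _ = _ := by
        rw [← Real.exp_nat_mul, ← Real.exp_nat_mul, ← Real.exp_add, hcast]
        congr 1
        rw [rate, hu]
        field_simp
        ring

/-- A bound for the probability of disconnection: the cut-off sets are split into those which
together with the deleted nodes make up at most the fraction `u₀` of all nodes, and the others. -/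
lemma selectionLaw_real_not_connected_le {n K : ℕ} (hK : K < n) {D : Finset (Fin n)}
    (hD : D.card < n) (hD0 : 0 < D.card) {u₀ u₁ δ : ℝ}
    (hu₁ : u₁ < 1) (hDu₁ : ((n : ℝ) + D.card) / 2 ≤ u₁ * n) (hδ : D.card + δ * n ≤ u₀ * n) :
    (selectionLaw n K).real {Γ | ¬ (remainingGraph Γ D).Connected} ≤
      (Real.exp (n * Real.exp (-(K * rate u₀))) - 1) +
        2 ^ n * Real.exp (-(δ * n * (K * rate u₁))) := by
  classical
  have := isProbabilityMeasure_selectionLaw hK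
  have hn0 : (0 : ℝ) < n := by exact_mod_cast (Nat.zero_le K).trans_lt hK
  set F := Dᶜ.powerset.filter fun S : Finset (Fin n) => S.Nonempty ∧ 2 * S.card ≤ n - D.card
    with hF
  set q := Real.exp (-(K * rate u₀)) with hq
  set E := Real.exp (-(δ * n * (K * rate u₁))) with hE
  have hsub : {Γ | ¬ (remainingGraph Γ D).Connected} ⊆
      ⋃ S ∈ F, {Γ : Fin n → Finset (Fin n) | ∀ i, Disjoint (Γ i) (cutLabels D S i)} := by
    intro Γ hΓ
    obtain ⟨S, h1, h2, h3, h4⟩ := exists_cutLabels_disjoint_of_not_connected hD hΓ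
    simp only [Set.mem_iUnion]
    exact ⟨S, by simp [hF, h1, h2, h3], h4⟩
  -- Adding the bounds of the two size regimes avoids splitting the sum over `F`.
  have hterm : ∀ S ∈ F, (selectionLaw n K).real {Γ | ∀ i, Disjoint (Γ i) (cutLabels D S i)} ≤
      q ^ S.card + E := by
    intro S hSF
    simp only [hF, Finset.mem_filter, Finset.mem_powerset] at hSF
    obtain ⟨hS, hS0, hSc⟩ := hSF
    have hr := hS0.card_pos
    refine (selectionLaw_real_cut_le hK hS hS0 (by omega) hD0).trans ?_
    have hu0 : (0 : ℝ) < (D.card + S.card) / n := by positivity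
    rcases le_total (((D.card : ℝ) + S.card) / n) u₀ with h | h
    · have hle : Real.exp (-(S.card * (K * rate ((D.card + S.card) / n)))) ≤ q ^ S.card := by
        rw [hq, ← Real.exp_nat_mul, mul_neg]
        gcongr
        exact rate_anti hu0 h
      exact hle.trans (le_add_of_nonneg_right (Real.exp_nonneg _))
    · have hle : Real.exp (-(S.card * (K * rate ((D.card + S.card) / n)))) ≤ E := by
        have h1 : δ * n ≤ S.card := by
          rw [le_div_iff₀ hn0] at h
          linarith
        -- A cut has at most half of the remaining nodes, so `D ∪ S` has at most `(n + D.card) / 2`.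
        have h2 : ((D.card : ℝ) + S.card) / n ≤ u₁ := by
          rw [div_le_iff₀ hn0]
          refine le_trans ?_ hDu₁
          have : (2 * S.card + D.card : ℝ) ≤ n := by exact_mod_cast (by omega)
          linarith
        have h3 := rate_anti hu0 h2
        have h4 := rate_pos (hu0.trans_le h2) hu₁
        rw [hE]
        gcongr
      exact hle.trans (le_add_of_nonneg_left (pow_nonneg (Real.exp_nonneg _) _))
  have hq0 : 0 ≤ q := Real.exp_nonneg _
  have hE0 : 0 ≤ E := Real.exp_nonneg _
  have hcard : Dᶜ.card ≤ n := by
    simpa using Finset.card_le_univ Dᶜ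
  -- Binomial theorem; leaving out the empty set gives the `-1` that makes the bound vanish as `n q
  -- → 0`.
  have hsum1 : ∑ S ∈ F, q ^ S.card ≤ Real.exp (n * q) - 1 := by
    have h1 : ∑ S ∈ F, q ^ S.card ≤ ∑ S ∈ Dᶜ.powerset.erase ∅, q ^ S.card := by
      refine Finset.sum_le_sum_of_subset_of_nonneg ?_ fun _ _ _ => pow_nonneg hq0 _
      intro S hS
      simp only [hF, Finset.mem_filter] at hS
      exact Finset.mem_erase.2 ⟨hS.2.1.ne_empty, hS.1⟩
    have h2 : ∑ S ∈ Dᶜ.powerset.erase ∅, q ^ S.card + 1 = (1 + q) ^ Dᶜ.card := by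
      have h3 := Finset.sum_erase_add (Dᶜ.powerset) (fun S => q ^ S.card)
        (Finset.empty_mem_powerset _)
      simp only [Finset.card_empty, pow_zero] at h3
      rw [h3, add_comm 1 q, ← Finset.sum_pow_mul_eq_add_pow]
      simp
    have h3 : (1 + q) ^ Dᶜ.card ≤ Real.exp (n * q) := by
      calc (1 + q) ^ Dᶜ.card ≤ (1 + q) ^ n := pow_le_pow_right₀ (by linarith) hcard
        _ ≤ Real.exp q ^ n := by
            refine pow_le_pow_left₀ (by linarith) ?_ n
            linarith [Real.add_one_le_exp q]
        _ = _ := by rw [← Real.exp_nat_mul]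
    linarith
  have hsum2 : (F.card : ℝ) ≤ 2 ^ n := by
    have h1 : F.card ≤ 2 ^ Dᶜ.card := by
      rw [← Finset.card_powerset]
      exact Finset.card_filter_le _ _
    exact_mod_cast h1.trans (Nat.pow_le_pow_right (by norm_num) hcard)
  calc _ ≤ (selectionLaw n K).real (⋃ S ∈ F,
        {Γ : Fin n → Finset (Fin n) | ∀ i, Disjoint (Γ i) (cutLabels D S i)}) :=
        measureReal_mono hsub (measure_ne_top _ _)
    _ ≤ ∑ S ∈ F, (selectionLaw n K).real {Γ | ∀ i, Disjoint (Γ i) (cutLabels D S i)} :=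
        measureReal_biUnion_finset_le _ _
    _ ≤ ∑ S ∈ F, (q ^ S.card + E) := Finset.sum_le_sum hterm
    _ = ∑ S ∈ F, q ^ S.card + F.card * E := by
        rw [Finset.sum_add_distrib, Finset.sum_const, nsmul_eq_mul]
    _ ≤ _ := by gcongr

/-! ### Isolated nodes -/

/-- Chebyshev's inequality for the number `X` of events that occur, whose mean is `M = s.card * p`.
-/
lemma real_iInter_compl_le_of_second_moment {Ω ι : Type*} [MeasurableSpace Ω] (μ : Measure Ω)
    [IsProbabilityMeasure μ] (s : Finset ι) (hs : s.Nonempty) (A : ι → Set Ω)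
    (hA : ∀ i, MeasurableSet (A i)) {p B : ℝ} (hp : 0 < p) (hB : 0 ≤ B)
    (h1 : ∀ i ∈ s, μ.real (A i) = p)
    (h2 : ∀ i ∈ s, ∀ j ∈ s, i ≠ j → μ.real (A i ∩ A j) ≤ B) :
    μ.real {ω | ∀ i ∈ s, ω ∉ A i} ≤ 1 / (s.card * p) + B / p ^ 2 - 1 := by
  classical
  set Z := {ω | ∀ i ∈ s, ω ∉ A i} with hZ
  have hZm : MeasurableSet Z := by
    have : Z = ⋂ i ∈ s, (A i)ᶜ := by ext; simp [hZ]
    rw [this]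
    exact Finset.measurableSet_biInter s fun i _ => (hA i).compl
  set M : ℝ := s.card * p with hM
  have hs0 : (0 : ℝ) < s.card := by exact_mod_cast hs.card_pos
  have hM0 : 0 < M := mul_pos hs0 hp
  let X : Ω → ℝ := fun ω => ∑ i ∈ s, (A i).indicator 1 ω
  have hint : ∀ T : Set Ω, MeasurableSet T → Integrable (T.indicator (1 : Ω → ℝ)) μ :=
    fun T hT => (integrable_const (1 : ℝ)).indicator hT
  have hX : Integrable X μ := integrable_finsetSum _ fun i _ => hint _ (hA i)
  have hXX : ∀ ω, X ω ^ 2 = ∑ i ∈ s, ∑ j ∈ s, (A i ∩ A j).indicator (1 : Ω → ℝ) ω := by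
    intro ω
    simp only [X, sq, Finset.sum_mul_sum, Set.inter_indicator_one, Pi.mul_apply]
  have hX2 : Integrable (fun ω => X ω ^ 2) μ := by
    simp only [hXX]
    exact integrable_finsetSum _ fun i _ => integrable_finsetSum _ fun j _ =>
      hint _ ((hA i).inter (hA j))
  have hEX : ∫ ω, X ω ∂μ = M := by
    simp only [X]
    rw [integral_finsetSum _ fun i _ => hint _ (hA i)]
    simp only [integral_indicator_one (hA _)]
    rw [Finset.sum_congr rfl h1, Finset.sum_const, nsmul_eq_mul]
  have hEX2 : ∫ ω, X ω ^ 2 ∂μ ≤ M + s.card ^ 2 * B := by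
    simp only [hXX]
    rw [integral_finsetSum _ fun i _ => integrable_finsetSum _ fun j _ =>
      hint _ ((hA i).inter (hA j))]
    have : ∀ i ∈ s, ∫ ω, ∑ j ∈ s, (A i ∩ A j).indicator (1 : Ω → ℝ) ω ∂μ ≤ p + s.card * B := by
      intro i hi
      rw [integral_finsetSum _ fun j _ => hint _ ((hA i).inter (hA j))]
      simp only [integral_indicator_one ((hA i).inter (hA _))]
      rw [← Finset.add_sum_erase s _ hi, Set.inter_self, h1 i hi]
      gcongr
      calc ∑ j ∈ s.erase i, μ.real (A i ∩ A j) ≤ ∑ j ∈ s.erase i, B :=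
            Finset.sum_le_sum fun j hj =>
              h2 i hi j (Finset.mem_of_mem_erase hj) (Finset.ne_of_mem_erase hj).symm
        _ = (s.erase i).card * B := by rw [Finset.sum_const, nsmul_eq_mul]
        _ ≤ s.card * B := by
            gcongr
            exact Finset.erase_subset _ _
    refine (Finset.sum_le_sum this).trans (le_of_eq ?_)
    rw [Finset.sum_const, nsmul_eq_mul, hM]
    ring
  -- On `Z` the count is zero, so `M ^ 2` times the indicator of `Z` is at most `(X - M) ^ 2`.
  have hkey : M ^ 2 * μ.real Z ≤ M + s.card ^ 2 * B - M ^ 2 := by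
    calc M ^ 2 * μ.real Z = ∫ ω, M ^ 2 * Z.indicator (1 : Ω → ℝ) ω ∂μ := by
          rw [integral_const_mul, integral_indicator_one hZm]
      _ ≤ ∫ ω, (X ω ^ 2 - 2 * M * X ω + M ^ 2) ∂μ := by
          refine integral_mono ((hint Z hZm).const_mul _)
            ((hX2.sub (hX.const_mul _)).add (integrable_const _)) fun ω => ?_
          by_cases hω : ω ∈ Z
          · have : X ω = 0 := Finset.sum_eq_zero fun i hi => by simp [hω i hi]
            simp [hω, this]
          · simp only [Set.indicator_of_notMem hω, mul_zero]
            nlinarith [sq_nonneg (X ω - M)]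
      _ = ∫ ω, X ω ^ 2 ∂μ - 2 * M * M + M ^ 2 := by
          have hXM : Integrable (fun ω => X ω ^ 2 - 2 * M * X ω) μ := hX2.sub (hX.const_mul _)
          rw [integral_add hXM (integrable_const _), integral_sub hX2 (hX.const_mul _), integral_const_mul, hEX]
          simp
      _ ≤ _ := by linarith
  have : 1 / (s.card * p) + B / p ^ 2 - 1 = (M + s.card ^ 2 * B - M ^ 2) / M ^ 2 := by
    rw [hM]
    field_simp
  rw [this, le_div_iff₀ (by positivity)]
  linarith

lemma not_connected_of_cutLabels_singleton {n : ℕ} {Γ : Fin n → Finset (Fin n)}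
    {D : Finset (Fin n)} (hD : D.card + 2 ≤ n) {i : Fin n} (hi : i ∉ D)
    (h : ∀ j, Disjoint (Γ j) (cutLabels D {i} j)) : ¬ (remainingGraph Γ D).Connected := by
  intro hc
  have hcard : Fintype.card {i : Fin n // i ∉ D} = n - D.card := by
    rw [Fintype.card_subtype_compl, Fintype.card_fin, Fintype.card_coe]
  have : Nontrivial {i : Fin n // i ∉ D} := Fintype.one_lt_card_iff_nontrivial.1 (by omega)
  obtain ⟨⟨j, hj⟩, hadj⟩ := hc.preconnected.exists_adj_of_nontrivial ⟨i, hi⟩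
  have hadj : i ≠ j ∧ (j ∈ Γ i ∨ i ∈ Γ j) := hadj
  have h1 : j ∈ cutLabels D {i} i → j ∉ Γ i := fun hm => Finset.disjoint_right.1 (h i) hm
  have h2 : i ∈ cutLabels D {i} j → i ∉ Γ j := fun hm => Finset.disjoint_right.1 (h j) hm
  simp only [cutLabels, Finset.mem_singleton, if_true, Finset.mem_sdiff, Finset.mem_compl, hj,
    not_false_eq_true, true_and, hadj.1.symm, if_false] at h1 h2
  tauto

/-- The probability that a given node is isolated. -/
lemma selectionLaw_real_isolated {n K : ℕ} (hK : K < n) {D : Finset (Fin n)} {i : Fin n}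
    (hi : i ∉ D) :
    (selectionLaw n K).real {Γ | ∀ j, Disjoint (Γ j) (cutLabels D {i} j)} =
      avoidProb n K (n - D.card - 1) * avoidProb n K 1 ^ (n - D.card - 1) := by
  rw [selectionLaw_real_forall_disjoint hK _ (notMem_cutLabels D {i}),
    prod_cutLabels hK (by simpa using hi)]
  simp

/-- The probability that two given nodes are isolated. -/
lemma selectionLaw_real_isolated_pair {n K : ℕ} (hK : K < n) {D : Finset (Fin n)} {i j : Fin n}
    (hi : i ∉ D) (hj : j ∉ D) (hij : i ≠ j) :
    (selectionLaw n K).real ({Γ | ∀ l, Disjoint (Γ l) (cutLabels D {i} l)} ∩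
        {Γ | ∀ l, Disjoint (Γ l) (cutLabels D {j} l)}) =
      avoidProb n K (n - D.card - 1) ^ 2 * avoidProb n K 2 ^ (n - D.card - 2) := by
  have hset : {Γ : Fin n → Finset (Fin n) | ∀ l, Disjoint (Γ l) (cutLabels D {i} l)} ∩
      {Γ | ∀ l, Disjoint (Γ l) (cutLabels D {j} l)} =
      {Γ | ∀ l, Disjoint (Γ l) (cutLabels D {i} l ∪ cutLabels D {j} l)} := by
    ext Γ
    simp [Finset.disjoint_union_right, forall_and]
  rw [hset, selectionLaw_real_forall_disjoint hK _ fun l => by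
    rw [Finset.mem_union, not_or]
    exact ⟨notMem_cutLabels D _ l, notMem_cutLabels D _ l⟩]
  have hsub : ({i, j} : Finset (Fin n)) ⊆ Dᶜ := by
    intro x
    simp only [Finset.mem_insert, Finset.mem_singleton, Finset.mem_compl]
    rintro (rfl | rfl) <;> assumption
  have hDc : Dᶜ.card = n - D.card := by rw [Finset.card_compl, Fintype.card_fin]
  have hpair : ({i, j} : Finset (Fin n)).card = 2 := Finset.card_pair hij
  rw [← Finset.prod_mul_prod_compl D, ← Finset.prod_sdiff hsub]
  have h1 : ∏ l ∈ D, avoidProb n K (cutLabels D {i} l ∪ cutLabels D {j} l).card = 1 := by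
    refine Finset.prod_eq_one fun l hl => ?_
    have hli : l ≠ i := fun e => hi (e ▸ hl)
    have hlj : l ≠ j := fun e => hj (e ▸ hl)
    simp [cutLabels, hl, hli, hlj, avoidProb_zero hK]
  have h2 : ∏ l ∈ Dᶜ \ {i, j}, avoidProb n K (cutLabels D {i} l ∪ cutLabels D {j} l).card =
      avoidProb n K 2 ^ (n - D.card - 2) := by
    rw [← hDc, ← hpair, ← Finset.card_sdiff_of_subset hsub]
    refine Finset.prod_eq_pow_card fun l hl => ?_
    simp only [Finset.mem_sdiff, Finset.mem_compl, Finset.mem_insert, Finset.mem_singleton,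
      not_or] at hl
    simp only [cutLabels, Finset.mem_singleton, hl, if_false]
    rfl
  have hcard : ∀ x ∉ D, (Dᶜ \ {x}).card = n - D.card - 1 := by
    intro x hx
    rw [Finset.card_sdiff_of_subset (by simpa using hx), hDc, Finset.card_singleton]
  have h3 : ∏ l ∈ {i, j}, avoidProb n K (cutLabels D {i} l ∪ cutLabels D {j} l).card =
      avoidProb n K (n - D.card - 1) ^ 2 := by
    rw [Finset.prod_pair hij, sq]
    -- The label `j`, which `i` must avoid for the sake of `j`, is already among those it avoids for
    -- its own isolation.
    have e1 : cutLabels D {i} i ∪ cutLabels D {j} i = Dᶜ \ {i} := by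
      simp only [cutLabels, Finset.mem_singleton, hij, hi, if_true, if_false]
      exact Finset.union_eq_left.2 (by simp [hj, hij.symm])
    have e2 : cutLabels D {i} j ∪ cutLabels D {j} j = Dᶜ \ {j} := by
      simp only [cutLabels, Finset.mem_singleton, hij.symm, hj, if_true, if_false]
      exact Finset.union_eq_right.2 (by simp [hi, hij])
    rw [e1, e2, hcard i hi, hcard j hj]
  rw [h1, h2, h3, one_mul, mul_comm]

/-- With `m = n - D.card`, two nodes are both isolated with probability at most `p ^ 2 / avoidProb n
K 1 ^ 2`: only `m - 2` nodes, not `m - 1`, are shared witnesses, which costs the two missing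
factors. -/
lemma selectionLaw_real_connected_le {n K : ℕ} (hK : K + 1 < n) {D : Finset (Fin n)}
    (hn : 3 ≤ n) (hD : D.card + 2 ≤ n) {p : ℝ} (hp : p =
      avoidProb n K (n - D.card - 1) * avoidProb n K 1 ^ (n - D.card - 1)) (hp0 : 0 < p) :
    (selectionLaw n K).real {Γ | (remainingGraph Γ D).Connected} ≤
      1 / ((n - D.card : ℕ) * p) + 1 / avoidProb n K 1 ^ 2 - 1 := by
  have hKn : K < n := by omega
  have := isProbabilityMeasure_selectionLaw hKn
  have hq0 : 0 < avoidProb n K 1 := by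
    refine lt_of_le_of_ne (avoidProb_nonneg _ _ _) fun h => hp0.ne' ?_
    rw [hp, ← h, zero_pow (by omega), mul_zero]
  have hDc : Dᶜ.card = n - D.card := by rw [Finset.card_compl, Fintype.card_fin]
  have hB : avoidProb n K (n - D.card - 1) ^ 2 * avoidProb n K 2 ^ (n - D.card - 2) ≤
      p ^ 2 / avoidProb n K 1 ^ 2 := by
    rw [le_div_iff₀ (by positivity), hp, mul_pow, mul_assoc]
    refine mul_le_mul_of_nonneg_left ?_ (sq_nonneg _)
    calc avoidProb n K 2 ^ (n - D.card - 2) * avoidProb n K 1 ^ 2 ≤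
          (avoidProb n K 1 ^ 2) ^ (n - D.card - 2) * avoidProb n K 1 ^ 2 := by
          gcongr
          · exact avoidProb_nonneg _ _ _
          · exact avoidProb_two_le hn hK
      _ = (avoidProb n K 1 ^ (n - D.card - 1)) ^ 2 := by
          rw [← pow_mul, ← pow_add, ← pow_mul]
          congr 1
          omega
  have h := real_iInter_compl_le_of_second_moment (selectionLaw n K) Dᶜ
    (Finset.card_pos.1 (by omega)) (fun i => {Γ | ∀ j, Disjoint (Γ j) (cutLabels D {i} j)})
    (fun i => MeasurableSet.of_discrete) hp0 (B := p ^ 2 / avoidProb n K 1 ^ 2) (by positivity)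
    (fun i hi => by rw [hp]; exact selectionLaw_real_isolated hKn (Finset.mem_compl.1 hi))
    (fun i hi j hj hij => (selectionLaw_real_isolated_pair hKn (Finset.mem_compl.1 hi)
      (Finset.mem_compl.1 hj) hij).le.trans hB)
  refine (measureReal_mono ?_).trans (h.trans (le_of_eq ?_))
  · intro Γ hΓ i hi hiso
    exact not_connected_of_cutLabels_singleton hD (Finset.mem_compl.1 hi) hiso hΓ
  · rw [hDc]
    congr 2
    field_simp

/-! ### Asymptotics -/

lemma tendsto_log_natCast_atTop : Tendsto (fun n : ℕ => Real.log n) atTop atTop :=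
  Real.tendsto_log_atTop.comp tendsto_natCast_atTop_atTop

lemma tendsto_div_log_of_isEquivalent {α c : ℝ} {K : ℕ → ℕ}
    (hKc : (fun n => (K n : ℝ)) ~[atTop] (fun n => c * threshold α n)) :
    Tendsto (fun n => (K n : ℝ) / Real.log n) atTop (𝓝 (c / rate α)) := by
  have h := hKc.div (IsEquivalent.refl (u := fun n : ℕ => Real.log n))
  refine h.symm.tendsto_nhds ((tendsto_congr' ?_).2 tendsto_const_nhds)
  filter_upwards [tendsto_log_natCast_atTop.eventually_gt_atTop 0] with n hn
  simp only [threshold, rate, Pi.div_apply]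
  field_simp

lemma tendsto_atTop_of_div_log {a : ℝ} (ha : 0 < a) {K : ℕ → ℕ}
    (hK : Tendsto (fun n => (K n : ℝ) / Real.log n) atTop (𝓝 a)) :
    Tendsto (fun n => (K n : ℝ)) atTop atTop := by
  refine (tendsto_congr' ?_).1 (hK.pos_mul_atTop ha tendsto_log_natCast_atTop)
  filter_upwards [tendsto_log_natCast_atTop.eventually_gt_atTop 0] with n hn
  field_simp

lemma tendsto_div_self_of_div_log {a : ℝ} {K : ℕ → ℕ}
    (hK : Tendsto (fun n => (K n : ℝ) / Real.log n) atTop (𝓝 a)) :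
    Tendsto (fun n => (K n : ℝ) / n) atTop (𝓝 0) := by
  have h1 : Tendsto (fun n : ℕ => Real.log n / n) atTop (𝓝 0) :=
    (Real.isLittleO_log_id_atTop.tendsto_div_nhds_zero).comp tendsto_natCast_atTop_atTop
  have h2 := hK.mul h1
  rw [mul_zero] at h2
  refine (tendsto_congr' ?_).1 h2
  filter_upwards [tendsto_log_natCast_atTop.eventually_gt_atTop 0] with n hn
  field_simp

lemma tendsto_div_of_abs_sub_lt_one {α : ℝ} {γ : ℕ → ℕ} (hγ : ∀ n, |(γ n : ℝ) - α * n| < 1) :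
    Tendsto (fun n => (γ n : ℝ) / n) atTop (𝓝 α) := by
  rw [tendsto_iff_norm_sub_tendsto_zero]
  refine squeeze_zero' (Eventually.of_forall fun _ => norm_nonneg _) ?_
    tendsto_one_div_atTop_nhds_zero_nat
  filter_upwards [eventually_gt_atTop 0] with n hn
  have hn0 : (0 : ℝ) < n := by exact_mod_cast hn
  rw [Real.norm_eq_abs, show (γ n : ℝ) / n - α = (γ n - α * n) / n by field_simp, abs_div,
    abs_of_pos hn0]
  exact div_le_div_of_nonneg_right (hγ n).le hn0.le

/-- By continuity: at `u = α` the product equals `c > 1`. -/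
lemma exists_rate_gt {α c : ℝ} (hα₀ : 0 < α) (hα₁ : α < 1) (hc : 1 < c) :
    ∃ u, α < u ∧ u < 1 ∧ 1 < c / rate α * rate u := by
  have hL := rate_pos hα₀ hα₁
  have hcont : ContinuousAt (fun u => c / rate α * rate u) α := by
    unfold rate
    have := Real.continuousAt_log hα₀.ne'
    fun_prop
  have h1 : ∀ᶠ u in 𝓝 α, 1 < c / rate α * rate u := by
    refine hcont.eventually_const_lt ?_
    simpa only [div_mul_cancel₀ _ hL.ne'] using hc
  have h2 : ∀ᶠ u in 𝓝[>] α, 1 < c / rate α * rate u := h1.filter_mono nhdsWithin_le_nhds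
  have h3 : ∀ᶠ u in 𝓝[>] α, u ∈ Set.Ioo α 1 := Ioo_mem_nhdsGT hα₁
  obtain ⟨u, hu, hu'⟩ := (h2.and h3).exists
  exact ⟨u, hu'.1, hu'.2, hu⟩

/-- The expression is `exp (log n * (1 - (K n / log n) * b))`, whose bracket tends to `1 - a * b <
0`. -/
lemma tendsto_natCast_mul_exp_neg {a b : ℝ} (hab : 1 < a * b) {K : ℕ → ℕ}
    (hK : Tendsto (fun n => (K n : ℝ) / Real.log n) atTop (𝓝 a)) :
    Tendsto (fun n : ℕ => (n : ℝ) * Real.exp (-(K n * b))) atTop (𝓝 0) := by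
  have h1 : Tendsto (fun n : ℕ => Real.log n * (1 - (K n : ℝ) / Real.log n * b)) atTop atBot := by
    refine tendsto_log_natCast_atTop.atTop_mul_neg (C := 1 - a * b) (by linarith) ?_
    exact (hK.mul_const b).const_sub 1
  refine (tendsto_congr' ?_).1 (Real.tendsto_exp_atBot.comp h1)
  filter_upwards [tendsto_log_natCast_atTop.eventually_gt_atTop 0, eventually_gt_atTop 0]
    with n hn hn0
  have hn0' : (0 : ℝ) < n := by exact_mod_cast hn0
  rw [Function.comp_apply, ← Real.exp_log hn0', ← Real.exp_add, Real.exp_log hn0']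
  congr 1
  field_simp
  ring

lemma tendsto_two_pow_mul_exp_neg {δ b : ℝ} (hδ : 0 < δ) (hb : 0 < b) {K : ℕ → ℕ}
    (hK : Tendsto (fun n => (K n : ℝ)) atTop atTop) :
    Tendsto (fun n : ℕ => (2 : ℝ) ^ n * Real.exp (-(δ * n * (K n * b)))) atTop (𝓝 0) := by
  have h1 : Tendsto (fun n : ℕ => Real.log 2 - δ * b * K n) atTop atBot :=
    tendsto_atBot_add_const_left _ _
      (tendsto_neg_atTop_atBot.comp (hK.const_mul_atTop (mul_pos hδ hb)))
  have h2 : Tendsto (fun n : ℕ => (n : ℝ) * (Real.log 2 - δ * b * K n)) atTop atBot :=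
    tendsto_natCast_atTop_atTop.atTop_mul_atBot₀ h1
  refine (Real.tendsto_exp_atBot.comp h2).congr fun n => ?_
  rw [Function.comp_apply, ← Real.exp_log (show (0 : ℝ) < 2 by norm_num), ← Real.exp_nat_mul,
    ← Real.exp_add, Real.exp_log (by norm_num)]
  congr 1
  ring

theorem tendsto_connectivityProb_one {α : ℝ} (hα₀ : 0 < α) (hα₁ : α < 1)
    {γ : ℕ → ℕ} (hγ : ∀ n, |(γ n : ℝ) - α * n| < 1) {K : ℕ → ℕ} (hK : IsScaling K) {c : ℝ}
    (hc : 1 < c) (hKc : (fun n => (K n : ℝ)) ~[atTop] (fun n => c * threshold α n)) :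
    Tendsto (fun n => connectivityProb n (K n) (γ n)) atTop (𝓝 1) := by
  have hL := rate_pos hα₀ hα₁
  have hKlog := tendsto_div_log_of_isEquivalent hKc
  have hKtop := tendsto_atTop_of_div_log (by positivity) hKlog
  obtain ⟨u₀, hu₀, hu₀1, hu₀c⟩ := exists_rate_gt hα₀ hα₁ hc
  -- Midpoint between 1 and `(1 + α) / 2`, the limit of the largest possible fraction. Below, `δ` is
  -- half the gap `u₀ - α`; the other half absorbs the rounding of `γ n`.
  set u₁ : ℝ := (3 + α) / 4 with hu₁
  set δ : ℝ := (u₀ - α) / 2 with hδ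
  have hδ0 : 0 < δ := by rw [hδ]; linarith
  set ε : ℕ → ℝ := fun n => (Real.exp (n * Real.exp (-(K n * rate u₀))) - 1) +
    2 ^ n * Real.exp (-(δ * n * (K n * rate u₁))) with hε
  have hεlim : Tendsto ε atTop (𝓝 0) := by
    have h1 := (Real.continuous_exp.tendsto 0).comp (tendsto_natCast_mul_exp_neg hu₀c hKlog)
    have h2 := tendsto_two_pow_mul_exp_neg hδ0
      (rate_pos (u := u₁) (by rw [hu₁]; linarith) (by rw [hu₁]; linarith)) hKtop
    have h3 := (h1.sub_const 1).add h2
    simpa using h3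
  have hlim : Tendsto (fun n => 1 - ε n) atTop (𝓝 1) := by simpa using hεlim.const_sub 1
  have hlarge : ∀ᶠ n : ℕ in atTop, 1 < α * n ∧ 2 < (1 - α) * n ∧ 1 < δ * n ∧ 3 ≤ n := by
    have h : ∀ a : ℝ, 0 < a → Tendsto (fun n : ℕ => a * n) atTop atTop := fun a ha =>
      tendsto_natCast_atTop_atTop.const_mul_atTop ha
    filter_upwards [(h α hα₀).eventually_gt_atTop 1,
      (h (1 - α) (by linarith)).eventually_gt_atTop 2, (h δ hδ0).eventually_gt_atTop 1,
      eventually_ge_atTop 3] with n h1 h2 h3 h4 using ⟨h1, h2, h3, h4⟩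
  refine tendsto_of_tendsto_of_tendsto_of_le_of_le' hlim tendsto_const_nhds ?_ ?_
  · filter_upwards [hlarge] with n ⟨h1, h2, h3, h4⟩
    have hγn := abs_lt.1 (hγ n)
    have hγ0 : 0 < γ n := by exact_mod_cast (by linarith : (0 : ℝ) < γ n)
    have hγlt : γ n < n := by exact_mod_cast (by linarith : (γ n : ℝ) < n)
    have hε0 : 0 ≤ ε n := by
      have : 1 ≤ Real.exp (n * Real.exp (-(K n * rate u₀))) := Real.one_le_exp (by positivity)
      have : 0 ≤ (2 : ℝ) ^ n * Real.exp (-(δ * n * (K n * rate u₁))) := by positivity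
      simp only [hε]
      linarith
    refine one_sub_le_connectivityProb (hK n h4).2 hγlt.le hε0 fun D hD => ?_
    refine selectionLaw_real_not_connected_le (hK n h4).2 (hD ▸ hγlt) (hD ▸ hγ0)
      (by rw [hu₁]; linarith) ?_ ?_
    · rw [hD, hu₁]
      linarith
    · rw [hD, show u₀ = α + 2 * δ by rw [hδ]; ring]
      linarith
  · filter_upwards [hlarge] with n ⟨h1, h2, h3, h4⟩
    have hγn := abs_lt.1 (hγ n)
    have hγlt : γ n < n := by exact_mod_cast (by linarith : (γ n : ℝ) < n)
    exact connectivityProb_le_one (hK n h4).2 hγlt.le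

/-- A lower bound for the probability that a given node is isolated. -/
lemma exp_le_isolatedProb {n K γ : ℕ} (hn : 2 ≤ n) (hKγ : K < γ) (hγn : γ < n) :
    Real.exp (-(K * (((n : ℝ) - γ - 1) / (n - 1) / avoidProb n K 1 -
        Real.log ((γ : ℝ) / n - K / n)))) ≤
      avoidProb n K (n - γ - 1) * avoidProb n K 1 ^ (n - γ - 1) := by
  have hn1 : (1 : ℝ) < n := by exact_mod_cast hn
  have hKγ' : (K : ℝ) < γ := by exact_mod_cast hKγ
  have hγn' : (γ : ℝ) + 1 ≤ n := by exact_mod_cast hγn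
  set q := avoidProb n K 1 with hq
  have hqe : q = 1 - (K : ℝ) / (n - 1 : ℝ) := avoidProb_one hn (by omega)
  have hq0 : 0 < q := by
    rw [hqe, sub_pos, div_lt_one (by linarith)]
    linarith
  have hy0 : 0 < (γ : ℝ) / n - K / n := by
    rw [← sub_div]
    exact div_pos (by linarith) (by linarith)
  have h1 : Real.exp (K * Real.log ((γ : ℝ) / n - K / n)) ≤ avoidProb n K (n - γ - 1) := by
    have h := pow_le_choose_div_choose (M := γ) (N := n - 1) (K := K) hKγ.le (by omega)
    -- An isolated node has to select within the `γ` deleted nodes.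
    rw [avoidProb, show n - 1 - (n - γ - 1) = γ by omega]
    refine le_trans ?_ h
    rw [mul_comm, Real.exp_mul, Real.exp_log hy0, Real.rpow_natCast, ← sub_div]
    rw [Nat.cast_sub (by omega), Nat.cast_one]
    rw [← sub_div] at hy0
    exact pow_le_pow_left₀ hy0.le
      (div_le_div_of_nonneg_left (by linarith) (by linarith) (by linarith)) K
  have h2 : Real.exp (-(K * (((n : ℝ) - γ - 1) / (n - 1) / q))) ≤ q ^ (n - γ - 1) := by
    -- The bound `log q ≥ 1 - 1 / q` loses only a factor `1 / q`, which tends to 1 in the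
    -- application.
    have hlog := Real.one_sub_inv_le_log_of_pos hq0
    rw [← Real.exp_log hq0, ← Real.exp_nat_mul, Real.exp_log hq0, Real.exp_le_exp,
      Nat.cast_sub (by omega), Nat.cast_sub (by omega), Nat.cast_one]
    have he : 1 - q⁻¹ = -((K : ℝ) / (n - 1) / q) := by
      have : (K : ℝ) / (n - 1) = 1 - q := by rw [hqe]; ring
      rw [this]
      field_simp
      ring
    calc -(K * (((n : ℝ) - γ - 1) / (n - 1) / q)) = ((n : ℝ) - γ - 1) * (1 - q⁻¹) := by
          rw [he]
          ring
      _ ≤ _ := mul_le_mul_of_nonneg_left hlog (by linarith)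
  calc _ = Real.exp (K * Real.log ((γ : ℝ) / n - K / n)) *
        Real.exp (-(K * (((n : ℝ) - γ - 1) / (n - 1) / q))) := by
        rw [← Real.exp_add]
        congr 1
        ring
    _ ≤ _ := mul_le_mul h1 h2 (Real.exp_nonneg _) (avoidProb_nonneg _ _ _)

theorem tendsto_connectivityProb_zero {α : ℝ} (hα₀ : 0 < α) (hα₁ : α < 1)
    {γ : ℕ → ℕ} (hγ : ∀ n, |(γ n : ℝ) - α * n| < 1) {K : ℕ → ℕ} (hK : IsScaling K) {c : ℝ}
    (hc : c < 1) (hKc : (fun n => (K n : ℝ)) ~[atTop] (fun n => c * threshold α n)) :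
    Tendsto (fun n => connectivityProb n (K n) (γ n)) atTop (𝓝 0) := by
  have hL := rate_pos hα₀ hα₁
  have hKlog := tendsto_div_log_of_isEquivalent hKc
  have hKn := tendsto_div_self_of_div_log hKlog
  have hγn := tendsto_div_of_abs_sub_lt_one hγ
  have hinv : Tendsto (fun n : ℕ => 1 / (n : ℝ)) atTop (𝓝 0) := tendsto_one_div_atTop_nhds_zero_nat
  have hdiff : Tendsto (fun n => (γ n : ℝ) / n - K n / n) atTop (𝓝 α) := by
    simpa using hγn.sub hKn
  have hlarge : ∀ᶠ n : ℕ in atTop, 3 ≤ n ∧ K n < γ n ∧ γ n + 2 ≤ n := by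
    have h : Tendsto (fun n : ℕ => (1 - α) * n) atTop atTop :=
      tendsto_natCast_atTop_atTop.const_mul_atTop (by linarith)
    filter_upwards [hdiff.eventually_const_lt hα₀, h.eventually_gt_atTop 2,
      eventually_ge_atTop 3] with n h1 h2 h3
    have hn0 : (0 : ℝ) < n := by exact_mod_cast (by omega : 0 < n)
    rw [← sub_div, div_pos_iff_of_pos_right hn0, sub_pos] at h1
    have hγ' := abs_lt.1 (hγ n)
    have h4 : (γ n : ℝ) + 1 < n := by linarith
    have h5 : γ n + 1 < n := by exact_mod_cast h4
    exact ⟨h3, by exact_mod_cast h1, by omega⟩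
  set q : ℕ → ℝ := fun n => avoidProb n (K n) 1 with hq
  have hqlim : Tendsto q atTop (𝓝 1) := by
    have h : Tendsto (fun n : ℕ => 1 - (K n : ℝ) / n / (1 - 1 / n)) atTop (𝓝 1) := by
      simpa using (hKn.div (hinv.const_sub 1) (by norm_num)).const_sub 1
    refine (tendsto_congr' ?_).1 h
    filter_upwards [eventually_ge_atTop 3] with n hn
    have hn1 : (1 : ℝ) < n := by exact_mod_cast (by omega : 1 < n)
    have hn2 : (n : ℝ) - 1 ≠ 0 := by linarith
    rw [hq]
    simp only
    rw [avoidProb_one (by omega) (hK n hn).2]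
    field_simp
  have hmlim : Tendsto (fun n : ℕ => ((n : ℝ) - γ n - 1) / (n - 1)) atTop (𝓝 (1 - α)) := by
    have h : Tendsto (fun n : ℕ => (1 - (γ n : ℝ) / n - 1 / n) / (1 - 1 / n)) atTop
        (𝓝 (1 - α)) := by
      have h := ((hγn.const_sub 1).sub hinv).div (hinv.const_sub 1) (by norm_num)
      simp only [sub_zero, div_one] at h
      exact h
    refine (tendsto_congr' ?_).1 h
    filter_upwards [eventually_ge_atTop 3] with n hn
    have hn1 : (1 : ℝ) < n := by exact_mod_cast (by omega : 1 < n)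
    have hn2 : (n : ℝ) - 1 ≠ 0 := by linarith
    field_simp
  -- Isolation costs at most `exp (-K n * ρ n)`; since `K n / n → 0`, the rate `ρ` has the same
  -- limit as in the upper bound for cuts.
  set ρ : ℕ → ℝ := fun n => ((n : ℝ) - γ n - 1) / (n - 1) / q n -
    Real.log ((γ n : ℝ) / n - K n / n) with hρ
  have hρlim : Tendsto ρ atTop (𝓝 (rate α)) := by
    have h := (hmlim.div hqlim one_ne_zero).sub (hdiff.log hα₀.ne')
    rw [div_one] at h
    exact h
  set p : ℕ → ℝ := fun n =>
    avoidProb n (K n) (n - γ n - 1) * avoidProb n (K n) 1 ^ (n - γ n - 1) with hp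
  have hnp : Tendsto (fun n : ℕ => (n : ℝ) * Real.exp (-(K n * ρ n))) atTop atTop := by
    have h1 : Tendsto (fun n : ℕ => Real.log n * (1 - (K n : ℝ) / Real.log n * ρ n))
        atTop atTop := by
      refine tendsto_log_natCast_atTop.atTop_mul_pos (C := 1 - c) (by linarith) ?_
      have h := (hKlog.mul hρlim).const_sub 1
      rwa [div_mul_cancel₀ _ hL.ne'] at h
    refine (tendsto_congr' ?_).1 (Real.tendsto_exp_atTop.comp h1)
    filter_upwards [tendsto_log_natCast_atTop.eventually_gt_atTop 0, eventually_gt_atTop 0]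
      with n hn hn0
    have hn0' : (0 : ℝ) < n := by exact_mod_cast hn0
    rw [Function.comp_apply, ← Real.exp_log hn0', ← Real.exp_add, Real.exp_log hn0']
    congr 1
    field_simp
    ring
  have hmp : Tendsto (fun n => ((n - γ n : ℕ) : ℝ) * p n) atTop atTop := by
    have h1 := (hγn.const_sub 1).pos_mul_atTop (by linarith) hnp
    refine tendsto_atTop_mono' _ ?_ h1
    filter_upwards [hlarge] with n ⟨hn, hKγ, hγ2⟩
    have hn0 : (n : ℝ) ≠ 0 := by exact_mod_cast (by omega : n ≠ 0)
    have h2 : Real.exp (-(K n * ρ n)) ≤ p n := exp_le_isolatedProb (by omega) hKγ (by omega)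
    rw [← mul_assoc, Nat.cast_sub (by omega), show (1 - (γ n : ℝ) / n) * n = n - γ n by field_simp]
    refine mul_le_mul_of_nonneg_left h2 ?_
    rw [sub_nonneg]
    exact_mod_cast (by omega : γ n ≤ n)
  have hεlim : Tendsto (fun n => 1 / (((n - γ n : ℕ) : ℝ) * p n) + 1 / q n ^ 2 - 1) atTop
      (𝓝 0) := by
    have h1 := hmp.inv_tendsto_atTop
    have h2 := (hqlim.pow 2).inv₀ (by norm_num)
    simpa [one_div] using (h1.add h2).sub_const 1
  refine squeeze_zero' (Eventually.of_forall fun _ => connectivityProb_nonneg _ _ _) ?_ hεlim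
  filter_upwards [hlarge] with n ⟨hn, hKγ, hγ2⟩
  have hp0 : 0 < p n :=
    (Real.exp_pos _).trans_le (exp_le_isolatedProb (by omega) hKγ (by omega))
  have hbound : ∀ D : Finset (Fin n), D.card = γ n →
      (selectionLaw n (K n)).real {Γ | (remainingGraph Γ D).Connected} ≤
        1 / (((n - γ n : ℕ) : ℝ) * p n) + 1 / q n ^ 2 - 1 := by
    intro D hD
    have h := selectionLaw_real_connected_le (K := K n) (D := D) (by omega) hn (by omega)
      (p := p n) (by rw [hD]) hp0
    rwa [hD] at h
  -- Some admissible `D` is needed only to see that the bound is nonnegative.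
  obtain ⟨D, -, hD⟩ := Finset.exists_subset_card_eq (s := (Finset.univ : Finset (Fin n)))
    (n := γ n) (by rw [Finset.card_univ, Fintype.card_fin]; omega)
  exact connectivityProb_le (by omega) (by omega)
    (measureReal_nonneg.trans (hbound D hD)) hbound

end KOut

/-- Zero-one law for connectivity of the random `K`-out graph under deletion of `γ n = α n`
nodes. When `α n` is not an integer, `γ n` is either of the two integers next to it. -/
theorem theorem1 (α : ℝ) (hα₀ : 0 < α) (hα₁ : α < 1)
    (γ : ℕ → ℕ) (hγ : ∀ n, |(γ n : ℝ) - α * n| < 1)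
    (K : ℕ → ℕ) (hK : KOut.IsScaling K)
    (c : ℝ) (hc : 0 < c)
    (hKc : (fun n => (K n : ℝ)) ~[atTop] (fun n => c * KOut.threshold α n)) :
    (1 < c → Tendsto (fun n => KOut.connectivityProb n (K n) (γ n)) atTop (𝓝 1)) ∧
    (c < 1 → Tendsto (fun n => KOut.connectivityProb n (K n) (γ n)) atTop (𝓝 0)) := by
  exact ⟨fun h => KOut.tendsto_connectivityProb_one hα₀ hα₁ hγ hK h hKc,
    fun h => KOut.tendsto_connectivityProb_zero hα₀ hα₁ hγ hK h hKc⟩
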